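/- **Setting.** Let $\mathcal C$ and $\mathcal A$ be finite sets of contexts and arms, let $\mathcal D$ be a distribution on $\mathcal C$, and for each $(c,a)$ let $L(c,a)$ be a random loss in $[0,1]$ with mean $\ell(c,a)$. Let $\mathcal F$ be a finite class of functions $\mathcal C\times\mathcal A\to[0,1]$ with $\ell\in\mathcal F$. In each round $k=1,\dots,K$ a fresh context $c_k\sim\mathcal D$ is drawn, independently of the past; the agent, who knows neither $\mathcal D$ nor $\ell$, draws $a_k\sim\pi_k(c_k,\cdot)$ and observes a fresh sample $\ell_k$ of $L(c_k,a_k)$. **Algorithm (OPO-CMAB) with parameters $\eta,\beta$.** Let $\pi_1(c,\cdot)$ be uniform for all $c$, let $\hat f_1\in\mathcal F$ be arbitrary, and for $k\ge 2$ let $\hat f_k\in\arg\min_{f\in\mathcal F}\sum_{i=1}^{k-1}(f(c_i,a_i)-\ell_i)^2$ be any least-squares solution, chosen on the basis of the past before $c_k$ is drawn. For $k\ge 1$ put $$b_k(c,a)=\min\Big\{1,\frac{\beta/2}{1+\sum_{i=1}^{k-1}\pi_i(c,a)}\Big\},\qquad \hat\ell_k(c,a)=\max\{0,\hat f_k(c,a)-b_k(c,a)\},$$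 $$\pi_{k+1}(c,a)=\frac{\pi_k(c,a)\exp(-\eta\hat\ell_k(c,a))}{\sum_{a'\in\mathcal A}\pi_k(c,a')\exp(-\eta\hat\ell_k(c,a'))}.$$ **Theorem (regret bound).** There is an absolute exponent $p\in\mathbb N$ such that for all $0<r_1\le r_2$ there is a constant $M>0$, depending only on $r_1,r_2$, with the following property. In the above setting let $K\ge1$, let $\delta\in(0,1)$ with $|\mathcal F|/\delta\ge 2$ (that is, $|\mathcal F|\ge2$ or $\delta\le 1/2$), let $\beta=\sqrt{34K\log(4|\mathcal F|K^3/\delta)/|\mathcal A|}$, and let $r_1\sqrt{\log|\mathcal A|/K}\le\eta\le r_2\sqrt{\log|\mathcal A|/K}$. If $\pi_\star$ is an optimal policy, i.e. $\pi_\star(c,\cdot)$ minimizes $\sum_a p(a)\,\ell(c,a)$ over the probability distributions $p$ on $\mathcal A$ for each $c$, then with probability at least $1-\delta$ the pseudo-regret of OPO-CMAB satisfies $$\mathcal R_K=\sum_{k=1}^K\sum_{a\in\mathcal A}\big(\pi_k(c_k,a)-\pi_\star(c_k,a)\big)\ell(c_k,a)\ \le\ M\,(1+\log K)^p\sqrt{K\,|\mathcal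 A|\,\log(|\mathcal F|/\delta)} .$$ -/

import Mathlib

open MeasureTheory ProbabilityTheory

namespace OPOCMAB

/-- A stochastic contextual multi-armed bandit with context set `C` and arm set `A`: an (unknown)
context distribution and, for each context-arm pair, the law of the random loss in `[0,1]`. -/
structure CMAB (C A : Type*) where
  /-- the context distribution -/
  ctxDist : PMF C
  /-- the law of the random loss of arm `a` in context `c` -/
  lossLaw : C → A → Measure ℝ
  isProbabilityMeasure : ∀ c a, IsProbabilityMeasure (lossLaw c a)
  lossLaw_Icc : ∀ c a, lossLaw c a (Set.Icc 0 1) = 1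

/-- The expected loss of arm `a` in context `c`. -/
noncomputable def CMAB.meanLoss {C A : Type*} (env : CMAB C A) (c : C) (a : A) : ℝ :=
  ∫ x, x ∂(env.lossLaw c a)

/-- The loss class `F` takes values in `[0,1]` and contains the true expected loss. -/
def Realizable {C A : Type*} (env : CMAB C A) (F : Finset (C → A → ℝ)) : Prop :=
  (∀ f ∈ F, ∀ c a, f c a ∈ Set.Icc (0 : ℝ) 1) ∧ ∃ f ∈ F, ∀ c a, f c a = env.meanLoss c a

/-- `f` is a least-squares regressor in `F` for the first `t` observations
`(ctx i, act i, loss i)`, `i < t`. When `t = 0` this only says `f ∈ F`. -/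
def IsLeastSquares {C A : Type*} (F : Finset (C → A → ℝ)) (t : ℕ)
    (ctx : ℕ → C) (act : ℕ → A) (loss : ℕ → ℝ) (f : C → A → ℝ) : Prop :=
  f ∈ F ∧ ∀ g ∈ F, ∑ i ∈ Finset.range t, (f (ctx i) (act i) - loss i) ^ 2
    ≤ ∑ i ∈ Finset.range t, (g (ctx i) (act i) - loss i) ^ 2

/-- The exploration bonus `min {1, (β/2) / (1 + s)}`, where `s` is the sum of the probabilities
that the past policies give to the arm in the context at hand. -/
noncomputable def bonus (β s : ℝ) : ℝ := min 1 (β / 2 / (1 + s))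

/-- The exponential-weights update of `p` along the loss vector `l` with learning rate `η`. -/
noncomputable def expUpdate {A : Type*} [Fintype A] (η : ℝ) (p l : A → ℝ) (a : A) : ℝ :=
  p a * Real.exp (-η * l a) / ∑ b, p b * Real.exp (-η * l b)

/-- The policies computed from the regressors `f 0, f 1, …`; rounds are numbered from `0`, so that
`policy η β f t` and `f t` are the policy and the regressor of the `(t+1)`-st round.
The first policy is uniform; the next one is the exponential-weights update of the current one along
the optimistic loss `max {0, f t - bonus}`. -/
noncomputable def policy {C A : Type*} [Fintype A] (η β : ℝ) (f : ℕ → C → A → ℝ) :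
    ℕ → C → A → ℝ
  | 0 => fun _ _ => 1 / (Fintype.card A : ℝ)
  | t + 1 => fun c => expUpdate η (policy η β f t c)
      (fun a => max 0 (f t c a - bonus β (∑ i : Fin t, policy η β f i c a)))
  termination_by t => t
  decreasing_by all_goals omega

/-- An optimal contextual policy: in every context, a distribution over the arms which minimizes
the expected loss. -/
def IsOptimalPolicy {C A : Type*} [Fintype A] (env : CMAB C A) (q : C → A → ℝ) : Prop :=
  ∀ c, q c ∈ stdSimplex ℝ A ∧
    ∀ p ∈ stdSimplex ℝ A, ∑ a, q c a * env.meanLoss c a ≤ ∑ a, p a * env.meanLoss c a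

/-- A run of `K` rounds of the algorithm with parameters `η`, `β` on the bandit `env`, on a
probability space `(Ω, P)`. The σ-algebra `ℱ t` is the information available before the context of
round `t` is seen (rounds are numbered from `0`); it contains at least the observations
`(ctx i, act i, loss i)`, `i < t`, and the regressors up to `fhat t`. -/
structure IsRun {C A Ω : Type*} [Fintype A] [mΩ : MeasurableSpace Ω]
    (env : CMAB C A) (F : Finset (C → A → ℝ)) (η β : ℝ) (K : ℕ) (P : Measure Ω)
    (ℱ : Filtration ℕ mΩ) (ctx : ℕ → Ω → C) (act : ℕ → Ω → A) (loss : ℕ → Ω → ℝ)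
    (fhat : ℕ → Ω → C → A → ℝ) : Prop where
  /-- The regressor of round `t` is known before the round starts. -/
  fhat_measurable : ∀ t < K, ∀ c a, Measurable[ℱ t] (fun ω => fhat t ω c a)
  /-- The regressor of round `t` is returned by an offline least-squares oracle on the past data. -/
  fhat_leastSquares : ∀ t < K, ∀ ω,
    IsLeastSquares F t (fun i => ctx i ω) (fun i => act i ω) (fun i => loss i ω) (fhat t ω)
  ctx_measurable : ∀ t < K, Measurable[ℱ (t + 1), ⊤] (ctx t)
  act_measurable : ∀ t < K, Measurable[ℱ (t + 1), ⊤] (act t)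
  loss_measurable : ∀ t < K, Measurable[ℱ (t + 1)] (loss t)
  /-- The conditional law of round `t` given the past: the context is fresh, with law `ctxDist`;
  given the past and the context `c`, the arm has law `policy … t c`; given the past, `c` and the
  arm `a`, the loss has law `lossLaw c a`. -/
  law : ∀ t < K, ∀ E, MeasurableSet[ℱ t] E → ∀ c a, ∀ B, MeasurableSet B →
    P (E ∩ {ω | ctx t ω = c ∧ act t ω = a ∧ loss t ω ∈ B}) =
      env.ctxDist c
        * (∫⁻ ω in E, ENNReal.ofReal (policy η β (fun i => fhat i ω) t c a) ∂P)
        * env.lossLaw c a B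

/-- The pseudo-regret over `K` rounds against the policy `q`, on a realization with contexts `ctx`
and regressors `f`. -/
noncomputable def regret {C A : Type*} [Fintype A] (env : CMAB C A) (η β : ℝ) (K : ℕ)
    (q : C → A → ℝ) (ctx : ℕ → C) (f : ℕ → C → A → ℝ) : ℝ :=
  ∑ t ∈ Finset.range K,
    ∑ a, (policy η β f t (ctx t) a - q (ctx t) a) * env.meanLoss (ctx t) a

/-- The exploration parameter `√(34 K log(4 N K³ / δ) / m)` for `m` arms and `N` functions. -/
noncomputable def explorationParam (K m N : ℕ) (δ : ℝ) : ℝ :=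
  Real.sqrt (34 * K * Real.log (4 * N * (K : ℝ) ^ 3 / δ) / m)

end OPOCMAB

/-! The argument is a deterministic regret analysis on the event that the regressors are accurate,
plus two exponential-moment concentration bounds.

Accuracy: for a fixed `f`, the excess squared loss over the true mean has conditional mean equal to
the squared error of `f` under the current policy, and variance of the same order. Hence an
exponential of "mean squared error minus excess loss" is a supermartingale (`IsRun.prob_excess_le`).
A union bound over rounds and over `F` covers the random regressors, whose excess loss is
nonpositive by the least-squares property. So with high probability the cumulative error of `fhat t`
under the past policies is at most `S`, of logarithmic size.

Regret: by AM-GM, the error of the regressor in any context and arm is at most the bonus plus `(1 +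
s) x² / (2β)` (`abs_le_bonus_add`). The average of the second term under any policy whatsoever is at
most `(1 + S) / (2β)` (`sum_mul_confidence_le`), so no comparison between the played and the optimal
policy is needed. The bonus is paid only by the played policy and sums to order `β |A| log K`.
Exponential weights, run in each context separately on the optimistic losses, costs order `√(K log
|A|)`. The choice of `β` balances the bonus against `K (1 + S) / β` (`expected_regret_le`,
`explorationParam_bounds`).

Finally `IsRun.prob_gain_le` passes from the expectation over contexts to the drawn contexts, losing
a factor `2`; it applies because the gap to an optimal policy is nonnegative. -/

namespace OPOCMAB

/-! ### The policies as probability distributions. -/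

section Policy

variable {C A : Type*} [Fintype A]

/-- The optimistic loss estimate `max {0, f t - bonus}` used by the update of round `t`. -/
noncomputable def optLoss (η β : ℝ) (f : ℕ → C → A → ℝ) (t : ℕ) (c : C) (a : A) : ℝ :=
  max 0 (f t c a - bonus β (∑ i ∈ Finset.range t, policy η β f i c a))

theorem policy_zero (η β : ℝ) (f : ℕ → C → A → ℝ) (c : C) (a : A) :
    policy η β f 0 c a = 1 / (Fintype.card A : ℝ) := by
  rw [policy]

theorem policy_succ (η β : ℝ) (f : ℕ → C → A → ℝ) (t : ℕ) (c : C) :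
    policy η β f (t + 1) c = expUpdate η (policy η β f t c) (optLoss η β f t c) := by
  have h : optLoss η β f t c = fun a =>
      max 0 (f t c a - bonus β (∑ i : Fin t, policy η β f i c a)) := by
    funext a
    rw [optLoss, Finset.sum_range]
  rw [policy, h]

theorem sum_expWeights_pos [Nonempty A] {p : A → ℝ} (hp : ∀ a, 0 < p a) (η : ℝ) (l : A → ℝ) :
    0 < ∑ a, p a * Real.exp (-η * l a) :=
  Finset.sum_pos (fun a _ => mul_pos (hp a) (Real.exp_pos _)) Finset.univ_nonempty

theorem expUpdate_pos [Nonempty A] {p : A → ℝ} (hp : ∀ a, 0 < p a) (η : ℝ) (l : A → ℝ) (a : A) :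
    0 < expUpdate η p l a :=
  div_pos (mul_pos (hp a) (Real.exp_pos _)) (sum_expWeights_pos hp η l)

theorem sum_expUpdate [Nonempty A] {p : A → ℝ} (hp : ∀ a, 0 < p a) (η : ℝ) (l : A → ℝ) :
    ∑ a, expUpdate η p l a = 1 := by
  simp only [expUpdate]
  rw [← Finset.sum_div]
  exact div_self (sum_expWeights_pos hp η l).ne'

theorem policy_pos [Nonempty A] (η β : ℝ) (f : ℕ → C → A → ℝ) (t : ℕ) (c : C) (a : A) :
    0 < policy η β f t c a := by
  induction t generalizing a with
  | zero =>
    rw [policy_zero]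
    exact one_div_pos.2 (Nat.cast_pos.2 Fintype.card_pos)
  | succ t ih =>
    rw [policy_succ]
    exact expUpdate_pos ih _ _ _

theorem sum_policy [Nonempty A] (η β : ℝ) (f : ℕ → C → A → ℝ) (t : ℕ) (c : C) :
    ∑ a, policy η β f t c a = 1 := by
  cases t with
  | zero => simp [policy_zero]
  | succ t =>
    rw [policy_succ]
    exact sum_expUpdate (policy_pos η β f t c) _ _

theorem policy_mem_stdSimplex [Nonempty A] (η β : ℝ) (f : ℕ → C → A → ℝ) (t : ℕ) (c : C) :
    policy η β f t c ∈ stdSimplex ℝ A :=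
  ⟨fun a => (policy_pos η β f t c a).le, sum_policy η β f t c⟩

theorem le_one_of_mem_stdSimplex {p : A → ℝ} (hp : p ∈ stdSimplex ℝ A) (a : A) : p a ≤ 1 :=
  hp.2 ▸ Finset.single_le_sum (fun b _ => hp.1 b) (Finset.mem_univ a)

theorem sum_mul_mem_Icc {p x : A → ℝ} (hp : p ∈ stdSimplex ℝ A)
    (hx : ∀ a, x a ∈ Set.Icc (0 : ℝ) 1) : ∑ a, p a * x a ∈ Set.Icc (0 : ℝ) 1 := by
  refine ⟨Finset.sum_nonneg fun a _ => mul_nonneg (hp.1 a) (hx a).1, ?_⟩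
  rw [← hp.2]
  exact Finset.sum_le_sum fun a _ => mul_le_of_le_one_right (hp.1 a) (hx a).2

end Policy

/-! ### Regret of exponential weights in a fixed context. -/

section ExponentialWeights

variable {A : Type*} [Fintype A] [Nonempty A]

/-- Follows from `1 + x + x² / 2 ≤ exp x`, because `(1 - x + x² / 2) (1 + x + x² / 2) = 1 + x⁴ / 4 ≥
1`. -/
theorem exp_neg_le_quadratic {x : ℝ} (hx : 0 ≤ x) : Real.exp (-x) ≤ 1 - x + x ^ 2 / 2 := by
  have h := Real.quadratic_le_exp_of_nonneg hx
  have h0 : 0 < 1 - x + x ^ 2 / 2 := by nlinarith [sq_nonneg (x - 1)]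
  rw [Real.exp_neg, inv_le_comm₀ (Real.exp_pos _) h0]
  refine le_trans ?_ h
  rw [inv_le_iff_one_le_mul₀ h0]
  nlinarith [sq_nonneg (x ^ 2)]

theorem log_sum_expWeights_le {p l : A → ℝ} (hp : p ∈ stdSimplex ℝ A) (hp0 : ∀ a, 0 < p a)
    {η : ℝ} (hη : 0 ≤ η) (hl : ∀ a, l a ∈ Set.Icc (0 : ℝ) 1) :
    Real.log (∑ a, p a * Real.exp (-η * l a)) ≤ -η * ∑ a, p a * l a + η ^ 2 / 2 := by
  have h1 : ∑ a, p a * Real.exp (-η * l a) ≤ ∑ a, (p a + -η * (p a * l a) + p a * (η ^ 2 / 2)) := by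
    refine Finset.sum_le_sum fun a _ => ?_
    have h := exp_neg_le_quadratic (mul_nonneg hη (hl a).1)
    have h2 : (η * l a) ^ 2 ≤ η ^ 2 := by
      rw [mul_pow]
      exact mul_le_of_le_one_right (sq_nonneg _) (pow_le_one₀ (hl a).1 (hl a).2)
    rw [neg_mul]
    calc p a * Real.exp (-(η * l a)) ≤ p a * (1 - η * l a + η ^ 2 / 2) := by
          refine mul_le_mul_of_nonneg_left ?_ (hp0 a).le
          linarith
      _ = _ := by ring
  rw [Finset.sum_add_distrib, Finset.sum_add_distrib, ← Finset.mul_sum, ← Finset.sum_mul, hp.2]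
    at h1
  have h3 := Real.log_le_sub_one_of_pos (sum_expWeights_pos hp0 η l)
  linarith

theorem log_expUpdate {p : A → ℝ} (hp : ∀ a, 0 < p a) (η : ℝ) (l : A → ℝ) (a : A) :
    Real.log (expUpdate η p l a) =
      Real.log (p a) - η * l a - Real.log (∑ b, p b * Real.exp (-η * l b)) := by
  rw [expUpdate, Real.log_div (mul_pos (hp a) (Real.exp_pos _)).ne' (sum_expWeights_pos hp η l).ne',
    Real.log_mul (hp a).ne' (Real.exp_pos _).ne', Real.log_exp]
  ring

/-- The potential `∑ q log p` is minus the relative entropy of `q` to `p`, up to the entropy of `q`,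
which cancels in the difference. -/
theorem expUpdate_potential {p q l : A → ℝ} (hp : p ∈ stdSimplex ℝ A) (hp0 : ∀ a, 0 < p a)
    (hq : q ∈ stdSimplex ℝ A) {η : ℝ} (hη : 0 ≤ η) (hl : ∀ a, l a ∈ Set.Icc (0 : ℝ) 1) :
    η * ∑ a, (p a - q a) * l a ≤
      ∑ a, q a * Real.log (expUpdate η p l a) - ∑ a, q a * Real.log (p a) + η ^ 2 / 2 := by
  have h := log_sum_expWeights_le hp hp0 hη hl
  have h2 : ∑ a, q a * Real.log (expUpdate η p l a) = ∑ a, q a * Real.log (p a)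
      - η * ∑ a, q a * l a - Real.log (∑ b, p b * Real.exp (-η * l b)) := by
    rw [← one_mul (Real.log (∑ b, _)), ← hq.2, Finset.sum_mul, Finset.mul_sum,
      ← Finset.sum_sub_distrib, ← Finset.sum_sub_distrib]
    refine Finset.sum_congr rfl fun a _ => ?_
    rw [log_expUpdate hp0]
    ring
  simp only [sub_mul, Finset.sum_sub_distrib]
  rw [h2]
  linarith

variable {C : Type*}

/-- The regret bound of exponential weights, in a fixed context, against the optimistic losses. -/
theorem expWeights_regret {η β : ℝ} {f : ℕ → C → A → ℝ} (hη : 0 ≤ η) {K : ℕ} {c : C} {q : A → ℝ}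
    (hq : q ∈ stdSimplex ℝ A) (hl : ∀ t < K, ∀ a, optLoss η β f t c a ∈ Set.Icc (0 : ℝ) 1) :
    η * ∑ t ∈ Finset.range K, ∑ a, (policy η β f t c a - q a) * optLoss η β f t c a ≤
      Real.log (Fintype.card A) + K * (η ^ 2 / 2) := by
  -- The potential starts at `-log |A|`, as the first policy is uniform, and never exceeds `0`.
  have key : ∀ n ≤ K,
      η * ∑ t ∈ Finset.range n, ∑ a, (policy η β f t c a - q a) * optLoss η β f t c a ≤
        ∑ a, q a * Real.log (policy η β f n c a) + Real.log (Fintype.card A) + n * (η ^ 2 / 2) := by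
    intro n
    induction n with
    | zero =>
      intro _
      simp [policy_zero, ← Finset.sum_mul, hq.2]
    | succ n ih =>
      intro hn
      have h1 := ih (by omega)
      have h2 := expUpdate_potential (policy_mem_stdSimplex η β f n c) (policy_pos η β f n c) hq hη
        (hl n (by omega))
      rw [Finset.sum_range_succ, mul_add, policy_succ]
      push_cast
      linarith
  refine (key K le_rfl).trans ?_
  have : ∑ a, q a * Real.log (policy η β f K c a) ≤ 0 :=
    Finset.sum_nonpos fun a _ => mul_nonpos_of_nonneg_of_nonpos (hq.1 a)
      (Real.log_nonpos (policy_pos η β f K c a).le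
        (le_one_of_mem_stdSimplex (policy_mem_stdSimplex η β f K c) a))
  linarith

end ExponentialWeights

/-! ### The exploration bonus. -/

section Bonus

theorem le_two_mul_log_one_add {y : ℝ} (h0 : 0 ≤ y) (h1 : y ≤ 1) : y ≤ 2 * Real.log (1 + y) := by
  have h := Real.one_sub_inv_le_log_of_pos (show (0 : ℝ) < 1 + y by linarith)
  have h2 : y / 2 ≤ 1 - (1 + y)⁻¹ := by
    have : 1 - (1 + y)⁻¹ = y / (1 + y) := by field_simp; ring
    rw [this]
    exact div_le_div_of_nonneg_left h0 (by linarith) (by linarith)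
  linarith

/-- Each summand is at most twice the increment of `log (1 + s)`, so the sum telescopes. -/
theorem sum_div_one_add_sum_le_log {x : ℕ → ℝ} (h0 : ∀ t, 0 ≤ x t) (h1 : ∀ t, x t ≤ 1) (n : ℕ) :
    ∑ t ∈ Finset.range n, x t / (1 + ∑ i ∈ Finset.range t, x i) ≤
      2 * Real.log (1 + ∑ t ∈ Finset.range n, x t) := by
  induction n with
  | zero => simp
  | succ n ih =>
    set s := ∑ t ∈ Finset.range n, x t with hs
    have hs0 : 0 ≤ s := Finset.sum_nonneg fun i _ => h0 i
    rw [Finset.sum_range_succ, Finset.sum_range_succ x, ← hs]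
    have h2 := le_two_mul_log_one_add (div_nonneg (h0 n) (by linarith : 0 ≤ 1 + s))
      ((div_le_one (by linarith)).2 (by linarith [h1 n]))
    have h3 : 1 + (s + x n) = (1 + s) * (1 + x n / (1 + s)) := by field_simp; ring
    have h4 : 0 ≤ x n / (1 + s) := div_nonneg (h0 n) (by linarith)
    rw [h3, Real.log_mul (by linarith) (by linarith)]
    linarith

theorem bonus_nonneg {β s : ℝ} (hβ : 0 ≤ β) (hs : 0 ≤ s) : 0 ≤ bonus β s :=
  le_min zero_le_one (by positivity)

/-- The bonus dominates the estimation error up to a multiple of the squared error. -/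
theorem abs_le_bonus_add {β s x : ℝ} (hβ : 0 < β) (hs : 0 ≤ s) (hx : |x| ≤ 1) :
    |x| ≤ bonus β s + (1 + s) * x ^ 2 / (2 * β) := by
  have h0 : 0 ≤ (1 + s) * x ^ 2 / (2 * β) := by positivity
  rw [bonus, ← min_add_add_right]
  refine le_min (by linarith) ?_
  rw [← sq_abs x]
  -- AM-GM as a completed square; the branch where the bonus equals `1` is covered by `|x| ≤ 1`.
  have h1 : β / 2 / (1 + s) + (1 + s) * |x| ^ 2 / (2 * β) - |x| =
      (β - (1 + s) * |x|) ^ 2 / (2 * β * (1 + s)) := by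
    field_simp
    ring
  have h2 : 0 ≤ (β - (1 + s) * |x|) ^ 2 / (2 * β * (1 + s)) := by positivity
  linarith

end Bonus

/-! ### Squared error and the confidence width under an arbitrary policy. -/

section SquaredError

variable {C A : Type*} [Fintype C] [Fintype A]

/-- The squared error of `g` against `l` under contexts from `d` and arms from `p`. -/
noncomputable def meanSqError (d : C → ℝ) (p : C → A → ℝ) (g l : C → A → ℝ) : ℝ :=
  ∑ c, d c * ∑ a, p c a * (g c a - l c a) ^ 2

/-- The policy `p` is unrelated to the weights `s`: the summand `1` costs at most `∑ p = 1` since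
squared errors are at most `1`, and in the `s` part `p` is simply bounded by `1`. -/
theorem sum_mul_confidence_le {d : C → ℝ} (hd : d ∈ stdSimplex ℝ C) {p g l s : C → A → ℝ}
    (hp : ∀ c, p c ∈ stdSimplex ℝ A) (hg : ∀ c a, |g c a - l c a| ≤ 1) (hs : ∀ c a, 0 ≤ s c a)
    {β : ℝ} (hβ : 0 < β) :
    ∑ c, d c * ∑ a, p c a * ((1 + s c a) * (g c a - l c a) ^ 2 / (2 * β)) ≤
      (1 + meanSqError d s g l) / (2 * β) := by
  have h : ∀ c, ∑ a, p c a * ((1 + s c a) * (g c a - l c a) ^ 2 / (2 * β)) ≤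
      (1 + ∑ a, s c a * (g c a - l c a) ^ 2) / (2 * β) := by
    intro c
    have h1 : (1 : ℝ) + ∑ a, s c a * (g c a - l c a) ^ 2 =
        ∑ a, (p c a + s c a * (g c a - l c a) ^ 2) := by
      rw [Finset.sum_add_distrib, (hp c).2]
    rw [h1, Finset.sum_div]
    refine Finset.sum_le_sum fun a _ => ?_
    rw [← mul_div_assoc]
    refine div_le_div_of_nonneg_right ?_ (by linarith)
    have h1 : (g c a - l c a) ^ 2 ≤ 1 := (sq_le_one_iff_abs_le_one _).2 (hg c a)
    have h2 := (hp c).1 a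
    have h3 := le_one_of_mem_stdSimplex (hp c) a
    have h4 : 0 ≤ s c a * (g c a - l c a) ^ 2 := mul_nonneg (hs c a) (sq_nonneg _)
    nlinarith
  refine (Finset.sum_le_sum fun c _ => mul_le_mul_of_nonneg_left (h c) (hd.1 c)).trans ?_
  have h1 : 1 + meanSqError d s g l =
      ∑ c, (d c + d c * ∑ a, s c a * (g c a - l c a) ^ 2) := by
    rw [Finset.sum_add_distrib, hd.2, meanSqError]
  rw [h1, Finset.sum_div]
  exact le_of_eq (Finset.sum_congr rfl fun c _ => by ring)

end SquaredError

/-! ### Regret on a realization with accurate regressors. -/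

section Deterministic

variable {C A : Type*} [Fintype A] [Nonempty A]

theorem optLoss_mem_Icc {η β : ℝ} (hβ : 0 ≤ β) {f : ℕ → C → A → ℝ} {t : ℕ} {c : C} {a : A}
    (hf : f t c a ∈ Set.Icc (0 : ℝ) 1) : optLoss η β f t c a ∈ Set.Icc (0 : ℝ) 1 := by
  have := bonus_nonneg hβ (Finset.sum_nonneg fun i (_ : i ∈ Finset.range t) =>
    (policy_pos η β f i c a).le)
  exact ⟨le_max_left _ _, max_le zero_le_one (by linarith [hf.2])⟩

theorem sum_policy_mul_bonus_le {η β : ℝ} (hβ : 0 ≤ β) (f : ℕ → C → A → ℝ) {K : ℕ} (hK : 1 ≤ K)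
    (c : C) :
    ∑ t ∈ Finset.range K, ∑ a, policy η β f t c a *
        bonus β (∑ i ∈ Finset.range t, policy η β f i c a) ≤
      β * Fintype.card A * (1 + Real.log K) := by
  rw [Finset.sum_comm]
  have key : ∀ a, ∑ t ∈ Finset.range K, policy η β f t c a *
      bonus β (∑ i ∈ Finset.range t, policy η β f i c a) ≤ β * (1 + Real.log K) := by
    intro a
    have hle : ∀ t, policy η β f t c a ≤ 1 := fun t =>
      le_one_of_mem_stdSimplex (policy_mem_stdSimplex η β f t c) a
    calc _ ≤ ∑ t ∈ Finset.range K, β / 2 *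
          (policy η β f t c a / (1 + ∑ i ∈ Finset.range t, policy η β f i c a)) := by
          refine Finset.sum_le_sum fun t _ => ?_
          refine (mul_le_mul_of_nonneg_left (min_le_right _ _) (policy_pos η β f t c a).le).trans ?_
          apply le_of_eq
          ring
      _ ≤ β / 2 * (2 * Real.log (1 + ∑ t ∈ Finset.range K, policy η β f t c a)) := by
          rw [← Finset.mul_sum]
          exact mul_le_mul_of_nonneg_left (sum_div_one_add_sum_le_log
            (fun t => (policy_pos η β f t c a).le) hle K) (by linarith)
      _ ≤ β / 2 * (2 * (1 + Real.log K)) := by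
          have hK' : (1 : ℝ) ≤ K := by exact_mod_cast hK
          have h0 : 0 ≤ ∑ t ∈ Finset.range K, policy η β f t c a :=
            Finset.sum_nonneg fun t _ => (policy_pos η β f t c a).le
          have h1 : ∑ t ∈ Finset.range K, policy η β f t c a ≤ K := by
            simpa using Finset.sum_le_sum fun t (_ : t ∈ Finset.range K) => hle t
          have h2 : Real.log (1 + ∑ t ∈ Finset.range K, policy η β f t c a) ≤
              Real.log (2 * K) := Real.log_le_log (by linarith) (by linarith)
          rw [Real.log_mul two_ne_zero (by positivity)] at h2
          have h3 := Real.log_two_lt_d9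
          refine mul_le_mul_of_nonneg_left ?_ (by linarith)
          linarith
      _ = _ := by ring
  refine (Finset.sum_le_sum fun a _ => key a).trans ?_
  rw [Finset.sum_const, Finset.card_univ, nsmul_eq_mul]
  exact le_of_eq (by ring)

variable [Fintype C]

/-- The expected regret on every realization on which the regressors are accurate. -/
theorem expected_regret_le {η β S : ℝ} {f : ℕ → C → A → ℝ} {K : ℕ} {d : C → ℝ} {l q : C → A → ℝ}
    (hη : 0 ≤ η) (hβ : 0 < β) (hK : 1 ≤ K) (hd : d ∈ stdSimplex ℝ C)
    (hq : ∀ c, q c ∈ stdSimplex ℝ A) (hl : ∀ c a, l c a ∈ Set.Icc (0 : ℝ) 1)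
    (hf : ∀ t < K, ∀ c a, f t c a ∈ Set.Icc (0 : ℝ) 1)
    (hS : ∀ t < K, ∑ i ∈ Finset.range t, meanSqError d (policy η β f i) (f t) l ≤ S) :
    η * ∑ t ∈ Finset.range K, ∑ c, d c * ∑ a, (policy η β f t c a - q c a) * l c a ≤
      Real.log (Fintype.card A) + K * (η ^ 2 / 2) +
        η * (2 * (β * Fintype.card A * (1 + Real.log K)) + K * ((1 + S) / β)) := by
  set s : ℕ → C → A → ℝ := fun t c a => ∑ i ∈ Finset.range t, policy η β f i c a with hs
  have hs0 : ∀ t c a, 0 ≤ s t c a := fun t c a =>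
    Finset.sum_nonneg fun i _ => (policy_pos η β f i c a).le
  have habs : ∀ t < K, ∀ c a, |f t c a - l c a| ≤ 1 := fun t ht c a => by
    rw [abs_le]
    constructor <;> linarith [(hf t ht c a).1, (hf t ht c a).2, (hl c a).1, (hl c a).2]
  have hsq : ∀ t < K, meanSqError d (s t) (f t) l ≤ S := fun t ht => by
    refine le_trans (le_of_eq ?_) (hS t ht)
    simp only [meanSqError, hs, Finset.sum_mul]
    rw [Finset.sum_comm]
    refine Finset.sum_congr rfl fun c _ => ?_
    rw [Finset.sum_comm, Finset.mul_sum]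
  let R : ℕ → C → A → ℝ := fun t c a => (1 + s t c a) * (f t c a - l c a) ^ 2 / (2 * β)
  -- Used once for the played policy and once for the comparator.
  have hconf : ∀ p : C → A → ℝ, (∀ c, p c ∈ stdSimplex ℝ A) → ∀ t < K,
      ∑ c, d c * ∑ a, p c a * R t c a ≤ (1 + S) / (2 * β) := fun p hp t ht =>
    (sum_mul_confidence_le hd hp (habs t ht) (hs0 t) hβ).trans
      (div_le_div_of_nonneg_right (by linarith [hsq t ht]) (by linarith))
  have hpt : ∀ t < K, ∀ c, ∑ a, (policy η β f t c a - q c a) * l c a ≤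
      ∑ a, (policy η β f t c a - q c a) * optLoss η β f t c a
        + 2 * ∑ a, policy η β f t c a * bonus β (s t c a)
        + (∑ a, policy η β f t c a * R t c a + ∑ a, q c a * R t c a) := by
    intro t ht c
    rw [Finset.mul_sum, ← Finset.sum_add_distrib, ← Finset.sum_add_distrib,
      ← Finset.sum_add_distrib]
    refine Finset.sum_le_sum fun a _ => ?_
    have h1 : -(bonus β (s t c a) + R t c a) ≤ f t c a - l c a ∧
        f t c a - l c a ≤ bonus β (s t c a) + R t c a :=
      abs_le.1 (abs_le_bonus_add hβ (hs0 t c a) (habs t ht c a))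
    have h0 : 0 ≤ R t c a := by
      have := hs0 t c a
      positivity
    have h2 : l c a - optLoss η β f t c a ≤ 2 * bonus β (s t c a) + R t c a := by
      have : f t c a - bonus β (s t c a) ≤ optLoss η β f t c a := le_max_right _ _
      linarith [h1.1]
    -- Optimism: subtracting the bonus cancels the bonus part of the error, so the comparator pays
    -- only `R`.
    have h3 : optLoss η β f t c a - l c a ≤ R t c a := by
      have : optLoss η β f t c a ≤ l c a + R t c a :=
        max_le (by linarith [(hl c a).1]) (by linarith [h1.2])
      linarith
    have h4 := mul_le_mul_of_nonneg_left h2 (policy_pos η β f t c a).le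
    have h5 := mul_le_mul_of_nonneg_left h3 ((hq c).1 a)
    linarith
  have hMD : ∀ c, η * ∑ t ∈ Finset.range K,
      ∑ a, (policy η β f t c a - q c a) * optLoss η β f t c a ≤
        Real.log (Fintype.card A) + K * (η ^ 2 / 2) := fun c =>
    expWeights_regret hη (hq c) fun t ht a => optLoss_mem_Icc hβ.le (hf t ht c a)
  have hsum : ∑ t ∈ Finset.range K, ∑ c, d c * ∑ a, (policy η β f t c a - q c a) * l c a ≤
      ∑ c, d c * ∑ t ∈ Finset.range K, ∑ a, (policy η β f t c a - q c a) * optLoss η β f t c a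
        + 2 * ∑ c, d c * ∑ t ∈ Finset.range K, ∑ a, policy η β f t c a * bonus β (s t c a)
        + K * ((1 + S) / β) := by
    calc _ ≤ ∑ t ∈ Finset.range K, (∑ c, d c * ∑ a,
            (policy η β f t c a - q c a) * optLoss η β f t c a
          + 2 * ∑ c, d c * ∑ a, policy η β f t c a * bonus β (s t c a) + (1 + S) / β) := by
          refine Finset.sum_le_sum fun t ht => ?_
          have ht' := Finset.mem_range.1 ht
          have h1 := hconf _ (policy_mem_stdSimplex η β f t) t ht'
          have h2 := hconf q hq t ht'
          have h3 := Finset.sum_le_sum fun c (_ : c ∈ Finset.univ) =>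
            mul_le_mul_of_nonneg_left (hpt t ht' c) (hd.1 c)
          simp only [mul_add, Finset.sum_add_distrib] at h3
          simp only [mul_left_comm _ (2 : ℝ), ← Finset.mul_sum] at h3
          have h4 : (1 + S) / β = (1 + S) / (2 * β) + (1 + S) / (2 * β) := by field_simp; ring
          linarith
      _ = _ := by
          rw [Finset.sum_add_distrib, Finset.sum_add_distrib, ← Finset.mul_sum, Finset.sum_comm,
            Finset.sum_comm (s := Finset.range K)]
          simp [Finset.mul_sum]
  have havg : ∀ {g : C → ℝ} {b : ℝ}, (∀ c, g c ≤ b) → ∑ c, d c * g c ≤ b := fun {g b} h => by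
    refine (Finset.sum_le_sum fun c _ => mul_le_mul_of_nonneg_left (h c) (hd.1 c)).trans ?_
    rw [← Finset.sum_mul, hd.2, one_mul]
  have h1 := havg hMD
  have h2 := havg fun c => sum_policy_mul_bonus_le (η := η) hβ.le f hK c
  simp only [mul_left_comm _ η, ← Finset.mul_sum] at h1
  have h3 := mul_le_mul_of_nonneg_left hsum hη
  have h4 := mul_le_mul_of_nonneg_left h2 hη
  rw [mul_add, mul_add] at h3
  linarith

end Deterministic

/-! ### Measurability and integration against a product conditional law. -/

section Measure

theorem measurable_apply_of_countable {Ω D E : Type*} {m : MeasurableSpace Ω} [MeasurableSpace E]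
    [Countable D] {X : Ω → D} (hX : Measurable[m, ⊤] X) {g : D → Ω → E}
    (hg : ∀ d, Measurable (g d)) : Measurable fun ω => g (X ω) ω := by
  intro s hs
  have h : (fun ω => g (X ω) ω) ⁻¹' s = ⋃ d, X ⁻¹' {d} ∩ g d ⁻¹' s := by
    ext ω
    simp
  rw [h]
  exact MeasurableSet.iUnion fun d => (hX trivial).inter (hg d hs)

/-- If the law of `X` on the set `S` given the σ-algebra `m` has the product form `k • w • ν`, then
integrals over `S` of products of an `m`-measurable function and a function of `X` factor. -/
theorem setLIntegral_mul_comp_of_law {Ω E : Type*} {m mΩ : MeasurableSpace Ω} [MeasurableSpace E]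
    (hm : m ≤ mΩ) {P : Measure Ω} {S : Set Ω} {X : Ω → E}
    (hX : Measurable X) {w : Ω → ENNReal} (hw : Measurable w) {k : ENNReal} {ν : Measure E}
    (hlaw : ∀ s, MeasurableSet[m] s → ∀ B, MeasurableSet B →
      P (s ∩ (S ∩ X ⁻¹' B)) = k * (∫⁻ ω in s, w ω ∂P) * ν B)
    {g : Ω → ENNReal} (hg : Measurable[m] g) {h : E → ENNReal} (hh : Measurable h) :
    ∫⁻ ω in S, g ω * h (X ω) ∂P = k * (∫⁻ ω, g ω * w ω ∂P) * ∫⁻ x, h x ∂ν := by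
  have hg' : Measurable g := hg.mono hm le_rfl
  have h1 : ∀ B, MeasurableSet B →
      ∫⁻ ω in X ⁻¹' B, g ω ∂(P.restrict S) = k * (∫⁻ ω, g ω * w ω ∂P) * ν B := by
    intro B hB
    -- The law is only known on sets of `m`, so the two measures are compared after trimming; this
    -- suffices because `g` is `m`-measurable.
    have htrim : ((P.restrict S).restrict (X ⁻¹' B)).trim hm =
        ((k * ν B) • P.withDensity w).trim hm := by
      refine @Measure.ext _ m _ _ fun s hs => ?_
      rw [trim_measurableSet_eq hm hs, trim_measurableSet_eq hm hs,
        Measure.restrict_restrict (hX hB), Measure.restrict_apply (hm s hs), Set.inter_comm _ S,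
        hlaw s hs B hB, Measure.smul_apply, withDensity_apply _ (hm s hs), smul_eq_mul]
      ring
    rw [← lintegral_trim hm hg, htrim, lintegral_trim hm hg, lintegral_smul_measure,
      lintegral_withDensity_eq_lintegral_mul _ hw hg', smul_eq_mul]
    simp only [Pi.mul_apply, mul_comm (w _)]
    ring
  have h2 : ((P.restrict S).withDensity g).map X = (k * ∫⁻ ω, g ω * w ω ∂P) • ν := by
    refine Measure.ext fun B hB => ?_
    rw [Measure.map_apply hX hB, withDensity_apply _ (hX hB), h1 B hB, Measure.smul_apply,
      smul_eq_mul]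
  have h3 := lintegral_map (μ := (P.restrict S).withDensity g) hh hX
  rw [h2, lintegral_smul_measure, smul_eq_mul] at h3
  rw [h3]
  exact (lintegral_withDensity_eq_lintegral_mul _ hg' (hh.comp hX)).symm

end Measure

/-! ### The environment: context probabilities and the loss of one round. -/

namespace CMAB

variable {C A : Type*} (env : CMAB C A)

/-- The probability of a context as a real number. -/
noncomputable def ctxProb (c : C) : ℝ := (env.ctxDist c).toReal

theorem ofReal_ctxProb (c : C) : ENNReal.ofReal (env.ctxProb c) = env.ctxDist c :=
  ENNReal.ofReal_toReal (env.ctxDist.apply_ne_top c)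

theorem ctxProb_mem_stdSimplex [Fintype C] : env.ctxProb ∈ stdSimplex ℝ C := by
  refine ⟨fun c => ENNReal.toReal_nonneg, ?_⟩
  simp only [ctxProb]
  rw [← ENNReal.toReal_sum fun c _ => env.ctxDist.apply_ne_top c, ← tsum_fintype (L := .unconditional C),
    env.ctxDist.tsum_coe, ENNReal.toReal_one]

theorem ae_lossLaw_mem_Icc (c : C) (a : A) :
    ∀ᵐ x ∂env.lossLaw c a, x ∈ Set.Icc (0 : ℝ) 1 := by
  have := env.isProbabilityMeasure c a
  exact (prob_compl_eq_zero_iff measurableSet_Icc).2 (env.lossLaw_Icc c a)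

theorem integrable_lossLaw (c : C) (a : A) : Integrable (fun x => x) (env.lossLaw c a) := by
  have := env.isProbabilityMeasure c a
  refine Integrable.of_bound (C := 1) aestronglyMeasurable_id ?_
  filter_upwards [env.ae_lossLaw_mem_Icc c a] with x hx
  rw [Real.norm_eq_abs, abs_le]
  exact ⟨by linarith [hx.1], hx.2⟩

/-- One-step exponential moment of the excess squared loss of a predictor. -/
theorem lintegral_exp_excess_le (c : C) (a : A) {y : ℝ} (hy : y ∈ Set.Icc (0 : ℝ) 1)
    (hl : env.meanLoss c a ∈ Set.Icc (0 : ℝ) 1) :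
    ∫⁻ x, ENNReal.ofReal (Real.exp (-(1 / 8) * ((y - x) ^ 2 - (env.meanLoss c a - x) ^ 2)))
        ∂env.lossLaw c a ≤ ENNReal.ofReal (1 - (y - env.meanLoss c a) ^ 2 / 16) := by
  have := env.isProbabilityMeasure c a
  set l := env.meanLoss c a with hldef
  set D := y - l with hD
  have hD1 : D ^ 2 ≤ 1 := by
    rw [sq_le_one_iff_abs_le_one, abs_le]
    constructor <;> linarith [hy.1, hy.2, hl.1, hl.2]
  -- An upper bound affine in `x`, so that its integral depends on the loss law only through the
  -- mean.
  let φ : ℝ → ℝ := fun x => 1 + -(1 / 8) * (D * (y + l)) + D ^ 2 / 16 + (1 / 4 * D) * x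
  have hpt : ∀ x ∈ Set.Icc (0 : ℝ) 1,
      Real.exp (-(1 / 8) * ((y - x) ^ 2 - (l - x) ^ 2)) ≤ φ x := by
    intro x hx
    set z := -(1 / 8) * ((y - x) ^ 2 - (l - x) ^ 2) with hz
    have hz1 : z = -(1 / 8) * (D * (y + l - 2 * x)) := by rw [hz, hD]; ring
    have hw : (y + l - 2 * x) ^ 2 ≤ 4 := by
      nlinarith [hy.1, hy.2, hl.1, hl.2, hx.1, hx.2]
    -- With rate `1/8` the mean of `z` is `-D² / 8`, so the quadratic term eats only half of the
    -- gain.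
    have hz2 : z ^ 2 ≤ D ^ 2 / 16 := by
      rw [hz1]
      nlinarith [mul_le_mul_of_nonneg_left hw (sq_nonneg D)]
    have hz3 : |z| ≤ 1 := (sq_le_one_iff_abs_le_one _).1 (by linarith)
    have h := (abs_le.1 (Real.abs_exp_sub_one_sub_id_le hz3)).2
    have : φ x = 1 + z + D ^ 2 / 16 := by rw [hz1]; ring
    linarith
  have hint : Integrable φ (env.lossLaw c a) :=
    (integrable_const _).add ((env.integrable_lossLaw c a).const_mul _)
  have hval : ∫ x, φ x ∂env.lossLaw c a = 1 - D ^ 2 / 16 := by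
    simp only [φ]
    rw [integral_add (integrable_const _) ((env.integrable_lossLaw c a).const_mul _),
      integral_const, integral_const_mul]
    change _ + 1 / 4 * D * l = _
    simp
    rw [hD]
    ring
  rw [← hval, ofReal_integral_eq_lintegral_ofReal hint]
  · refine lintegral_mono_ae ?_
    filter_upwards [env.ae_lossLaw_mem_Icc c a] with x hx
    exact ENNReal.ofReal_le_ofReal (hpt x hx)
  · filter_upwards [env.ae_lossLaw_mem_Icc c a] with x hx
    exact (Real.exp_pos _).le.trans (hpt x hx)

end CMAB

/-! ### Exponential supermartingales along a run. -/

section Run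

variable {C A Ω : Type*} [Fintype A] [mΩ : MeasurableSpace Ω]
  {env : CMAB C A} {F : Finset (C → A → ℝ)} {η β : ℝ} {K : ℕ} {P : Measure Ω}
  {ℱ : Filtration ℕ mΩ} {ctx : ℕ → Ω → C} {act : ℕ → Ω → A} {loss : ℕ → Ω → ℝ}
  {fhat : ℕ → Ω → C → A → ℝ}

theorem IsRun.policy_measurable (hrun : IsRun env F η β K P ℱ ctx act loss fhat) :
    ∀ t ≤ K, ∀ c a, Measurable[ℱ t] fun ω => policy η β (fun i => fhat i ω) t c a := by
  intro t
  -- Strong induction, because the bonus involves all earlier policies.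
  induction t using Nat.strong_induction_on with
  | _ t ih =>
    intro ht c a
    cases t with
    | zero =>
      simp only [policy_zero]
      exact measurable_const
    | succ t =>
      have hp : ∀ i ≤ t, ∀ b, Measurable[ℱ (t + 1)]
          fun ω => policy η β (fun i => fhat i ω) i c b := fun i hi b =>
        (ih i (by omega) (by omega) c b).mono (ℱ.mono (by omega)) le_rfl
      have hl : ∀ b, Measurable[ℱ (t + 1)]
          fun ω => optLoss η β (fun i => fhat i ω) t c b := by
        intro b
        have h1 : Measurable[ℱ (t + 1)] fun ω =>
            ∑ i ∈ Finset.range t, policy η β (fun i => fhat i ω) i c b :=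
          Finset.measurable_fun_sum _ fun i hi => hp i (Finset.mem_range.1 hi).le b
        have h2 := (hrun.fhat_measurable t (by omega) c b).mono (ℱ.mono (Nat.le_succ t)) le_rfl
        exact measurable_const.max (h2.sub (measurable_const.min
          (measurable_const.div (measurable_const.add h1))))
      have h3 : ∀ b, Measurable[ℱ (t + 1)] fun ω => policy η β (fun i => fhat i ω) t c b *
          Real.exp (-η * optLoss η β (fun i => fhat i ω) t c b) := fun b =>
        (hp t le_rfl b).mul (Real.measurable_exp.comp (measurable_const.mul (hl b)))
      simp only [policy_succ, expUpdate]
      exact (h3 a).div (Finset.measurable_fun_sum _ fun b _ => h3 b)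

variable [Fintype C]

theorem IsRun.increment_measurable (hrun : IsRun env F η β K P ℱ ctx act loss fhat)
    {u : ℕ → Ω → C → A → ℝ} {h : C → A → ℝ → ℝ}
    (hu : ∀ t < K, ∀ c a, Measurable[ℱ t] fun ω => u t ω c a) (hh : ∀ c a, Measurable (h c a))
    {t : ℕ} (ht : t < K) :
    Measurable[ℱ (t + 1)] fun ω => u t ω (ctx t ω) (act t ω) +
      h (ctx t ω) (act t ω) (loss t ω) := by
  refine measurable_apply_of_countable (m := ℱ (t + 1)) (hrun.ctx_measurable t ht)
    (g := fun c ω => u t ω c (act t ω) + h c (act t ω) (loss t ω)) fun c => ?_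
  refine measurable_apply_of_countable (m := ℱ (t + 1)) (hrun.act_measurable t ht)
    (g := fun a ω => u t ω c a + h c a (loss t ω)) fun a => ?_
  exact ((hu t ht c a).mono (ℱ.mono (Nat.le_succ t)) le_rfl).add
    ((hh c a).comp (hrun.loss_measurable t ht))

/-- The law of one round of a run, integrated. -/
theorem IsRun.lintegral_round (hrun : IsRun env F η β K P ℱ ctx act loss fhat) {t : ℕ}
    (ht : t < K) {g : Ω → C → A → ENNReal} (hg : ∀ c a, Measurable[ℱ t] fun ω => g ω c a)
    {h : C → A → ℝ → ENNReal} (hh : ∀ c a, Measurable (h c a)) :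
    ∫⁻ ω, g ω (ctx t ω) (act t ω) * h (ctx t ω) (act t ω) (loss t ω) ∂P =
      ∑ c, ∑ a, env.ctxDist c *
        (∫⁻ ω, g ω c a * ENNReal.ofReal (policy η β (fun i => fhat i ω) t c a) ∂P) *
        ∫⁻ x, h c a x ∂env.lossLaw c a := by
  classical
  let S : C → A → Set Ω := fun c a => {ω | ctx t ω = c ∧ act t ω = a}
  have hS : ∀ c a, MeasurableSet (S c a) := fun c a =>
    (ℱ.le (t + 1) _ ((hrun.ctx_measurable t ht) (show MeasurableSet[⊤] {c} from trivial))).inter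
      (ℱ.le (t + 1) _ ((hrun.act_measurable t ht) (show MeasurableSet[⊤] {a} from trivial)))
  have hloss : Measurable (loss t) := (hrun.loss_measurable t ht).mono (ℱ.le (t + 1)) le_rfl
  have hpt : ∀ ω, g ω (ctx t ω) (act t ω) * h (ctx t ω) (act t ω) (loss t ω) =
      ∑ c, ∑ a, (S c a).indicator (fun ω => g ω c a * h c a (loss t ω)) ω := by
    intro ω
    rw [Finset.sum_eq_single (ctx t ω), Finset.sum_eq_single (act t ω)]
    · simp [S]
    · intro a _ ha
      simp [S, ha.symm]
    · simp
    · intro c _ hc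
      simp [S, hc.symm]
    · simp
  have hmeas : ∀ c a, Measurable ((S c a).indicator fun ω => g ω c a * h c a (loss t ω)) :=
    fun c a => (((hg c a).mono (ℱ.le t) le_rfl).mul ((hh c a).comp hloss)).indicator (hS c a)
  simp only [hpt]
  rw [lintegral_finsetSum _ fun c _ => Finset.measurable_fun_sum _ fun a _ => hmeas c a]
  refine Finset.sum_congr rfl fun c _ => ?_
  rw [lintegral_finsetSum _ fun a _ => hmeas c a]
  refine Finset.sum_congr rfl fun a _ => ?_
  rw [lintegral_indicator (hS c a)]
  refine setLIntegral_mul_comp_of_law (ℱ.le t) hloss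
    (((hrun.policy_measurable t ht.le c a).mono (ℱ.le t) le_rfl).ennreal_ofReal) ?_ (hg c a)
    (hh c a)
  intro s hs B hB
  rw [← hrun.law t ht s hs c a B hB]
  congr 2
  ext ω
  simp [S, and_assoc]

/-- If the conditional exponential moment of each increment is at most one, then so is the
exponential moment of the sum. -/
theorem IsRun.lintegral_exp_sum_le_one [Nonempty A] [IsProbabilityMeasure P]
    (hrun : IsRun env F η β K P ℱ ctx act loss fhat)
    {u : ℕ → Ω → C → A → ℝ} {h : C → A → ℝ → ℝ} {H : C → A → ℝ}
    (hu : ∀ t < K, ∀ c a, Measurable[ℱ t] fun ω => u t ω c a) (hh : ∀ c a, Measurable (h c a))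
    (hH0 : ∀ c a, 0 ≤ H c a)
    (hH : ∀ c a, ∫⁻ x, ENNReal.ofReal (Real.exp (h c a x)) ∂env.lossLaw c a ≤
      ENNReal.ofReal (H c a))
    (hle : ∀ t < K, ∀ ω, ∑ c, env.ctxProb c * ∑ a,
      Real.exp (u t ω c a) * policy η β (fun i => fhat i ω) t c a * H c a ≤ 1) :
    ∀ n ≤ K, ∫⁻ ω, ENNReal.ofReal (Real.exp (∑ t ∈ Finset.range n,
      (u t ω (ctx t ω) (act t ω) + h (ctx t ω) (act t ω) (loss t ω)))) ∂P ≤ 1 := by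
  intro n
  induction n with
  | zero => simp
  | succ n ih =>
    intro hn
    -- The exponential of the first `n` increments is known before round `n`, so it joins the
    -- predictable factor in `lintegral_round`.
    let Z : Ω → ENNReal := fun ω => ENNReal.ofReal (Real.exp (∑ t ∈ Finset.range n,
      (u t ω (ctx t ω) (act t ω) + h (ctx t ω) (act t ω) (loss t ω))))
    have hZ : Measurable[ℱ n] Z := by
      refine ENNReal.measurable_ofReal.comp (Real.measurable_exp.comp ?_)
      refine Finset.measurable_fun_sum _ fun t ht => ?_
      have := Finset.mem_range.1 ht
      exact (hrun.increment_measurable hu hh (by omega)).mono (ℱ.mono (by omega)) le_rfl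
    have hu' : ∀ c a, Measurable[ℱ n] fun ω => ENNReal.ofReal (Real.exp (u n ω c a)) :=
      fun c a => ENNReal.measurable_ofReal.comp (Real.measurable_exp.comp (hu n hn c a))
    have hpol : ∀ c a, Measurable
        fun ω => ENNReal.ofReal (policy η β (fun i => fhat i ω) n c a) := fun c a =>
      ((hrun.policy_measurable n (by omega) c a).mono (ℱ.le n) le_rfl).ennreal_ofReal
    have hstep := hrun.lintegral_round hn
      (g := fun ω c a => Z ω * ENNReal.ofReal (Real.exp (u n ω c a)))
      (fun c a => hZ.mul (hu' c a))
      (h := fun c a x => ENNReal.ofReal (Real.exp (h c a x)))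
      (fun c a => ENNReal.measurable_ofReal.comp (Real.measurable_exp.comp (hh c a)))
    have hterm : ∀ c a, Measurable fun ω => Z ω * ENNReal.ofReal (Real.exp (u n ω c a)) *
        ENNReal.ofReal (policy η β (fun i => fhat i ω) n c a) := fun c a =>
      ((hZ.mul (hu' c a)).mono (ℱ.le n) le_rfl).mul (hpol c a)
    calc _ = ∫⁻ ω, Z ω * ENNReal.ofReal (Real.exp (u n ω (ctx n ω) (act n ω))) *
          ENNReal.ofReal (Real.exp (h (ctx n ω) (act n ω) (loss n ω))) ∂P := by
          refine lintegral_congr fun ω => ?_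
          rw [Finset.sum_range_succ, Real.exp_add, Real.exp_add,
            ENNReal.ofReal_mul (Real.exp_pos _).le, ENNReal.ofReal_mul (Real.exp_pos _).le,
            mul_assoc]
      _ ≤ ∑ c, ∑ a, ∫⁻ ω, env.ctxDist c * ENNReal.ofReal (H c a) *
            (Z ω * ENNReal.ofReal (Real.exp (u n ω c a)) *
              ENNReal.ofReal (policy η β (fun i => fhat i ω) n c a)) ∂P := by
          rw [hstep]
          refine Finset.sum_le_sum fun c _ => Finset.sum_le_sum fun a _ => ?_
          rw [lintegral_const_mul _ (hterm c a), mul_right_comm]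
          gcongr
          exact hH c a
      _ = ∫⁻ ω, Z ω * ENNReal.ofReal (∑ c, env.ctxProb c * ∑ a,
            Real.exp (u n ω c a) * policy η β (fun i => fhat i ω) n c a * H c a) ∂P := by
          simp only [← lintegral_finsetSum _ fun a (_ : a ∈ Finset.univ) =>
            (hterm _ a).const_mul _]
          rw [← lintegral_finsetSum _ fun c _ => Finset.measurable_fun_sum _ fun a _ =>
            (hterm c a).const_mul _]
          refine lintegral_congr fun ω => ?_
          have hd := env.ctxProb_mem_stdSimplex.1
          have h0 : ∀ c a, 0 ≤ Real.exp (u n ω c a) * policy η β (fun i => fhat i ω) n c a *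
              H c a := fun c a =>
            mul_nonneg (mul_nonneg (Real.exp_pos _).le (policy_pos η β _ n c a).le) (hH0 c a)
          rw [ENNReal.ofReal_sum_of_nonneg fun c _ =>
            mul_nonneg (hd c) (Finset.sum_nonneg fun a _ => h0 c a),
            Finset.mul_sum]
          refine Finset.sum_congr rfl fun c _ => ?_
          rw [ENNReal.ofReal_mul (hd c), env.ofReal_ctxProb,
            ENNReal.ofReal_sum_of_nonneg fun a _ => h0 c a, Finset.mul_sum, Finset.mul_sum]
          refine Finset.sum_congr rfl fun a _ => ?_
          rw [ENNReal.ofReal_mul (mul_nonneg (Real.exp_pos _).le (policy_pos η β _ n c a).le),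
            ENNReal.ofReal_mul (Real.exp_pos _).le]
          ring
      _ ≤ ∫⁻ ω, Z ω ∂P := by
          refine lintegral_mono fun ω => mul_le_of_le_one_right' ?_
          exact ENNReal.ofReal_le_one.2 (hle n hn ω)
      _ ≤ 1 := ih (by omega)

/-- Markov's inequality for `IsRun.lintegral_exp_sum_le_one`. -/
theorem IsRun.prob_log_le_sum_le [Nonempty A] [IsProbabilityMeasure P]
    (hrun : IsRun env F η β K P ℱ ctx act loss fhat)
    {u : ℕ → Ω → C → A → ℝ} {h : C → A → ℝ → ℝ} {H : C → A → ℝ}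
    (hu : ∀ t < K, ∀ c a, Measurable[ℱ t] fun ω => u t ω c a) (hh : ∀ c a, Measurable (h c a))
    (hH0 : ∀ c a, 0 ≤ H c a)
    (hH : ∀ c a, ∫⁻ x, ENNReal.ofReal (Real.exp (h c a x)) ∂env.lossLaw c a ≤
      ENNReal.ofReal (H c a))
    (hle : ∀ t < K, ∀ ω, ∑ c, env.ctxProb c * ∑ a,
      Real.exp (u t ω c a) * policy η β (fun i => fhat i ω) t c a * H c a ≤ 1)
    {n : ℕ} (hn : n ≤ K) {ε : ℝ} (hε : 0 < ε) :
    P.real {ω | Real.log (1 / ε) ≤ ∑ t ∈ Finset.range n,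
      (u t ω (ctx t ω) (act t ω) + h (ctx t ω) (act t ω) (loss t ω))} ≤ ε := by
  have h1 := hrun.lintegral_exp_sum_le_one hu hh hH0 hH hle n hn
  have hmeas : Measurable fun ω => ENNReal.ofReal (Real.exp (∑ t ∈ Finset.range n,
      (u t ω (ctx t ω) (act t ω) + h (ctx t ω) (act t ω) (loss t ω)))) := by
    refine ENNReal.measurable_ofReal.comp (Real.measurable_exp.comp ?_)
    refine Finset.measurable_fun_sum _ fun t ht => ?_
    exact (hrun.increment_measurable hu hh ((Finset.mem_range.1 ht).trans_le hn)).mono (ℱ.le _)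
      le_rfl
  have h2 := (mul_meas_ge_le_lintegral (μ := P) hmeas (ENNReal.ofReal (1 / ε))).trans h1
  have h3 : {ω | Real.log (1 / ε) ≤ ∑ t ∈ Finset.range n,
      (u t ω (ctx t ω) (act t ω) + h (ctx t ω) (act t ω) (loss t ω))} =
      {ω | ENNReal.ofReal (1 / ε) ≤ ENNReal.ofReal (Real.exp (∑ t ∈ Finset.range n,
      (u t ω (ctx t ω) (act t ω) + h (ctx t ω) (act t ω) (loss t ω))))} := by
    ext ω
    rw [Set.mem_ofPred_eq, Set.mem_ofPred_eq, ENNReal.ofReal_le_ofReal_iff (Real.exp_pos _).le,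
      Real.log_le_iff_le_exp (by positivity)]
  rw [← h3] at h2
  have h4 := ENNReal.toReal_mono ENNReal.one_ne_top h2
  rw [ENNReal.toReal_mul, ENNReal.toReal_ofReal (by positivity), ENNReal.toReal_one,
    div_mul_eq_mul_div, one_mul, div_le_one hε] at h4
  exact h4

/-- The mean squared error of a fixed predictor is controlled by its empirical excess loss. -/
theorem IsRun.prob_excess_le [Nonempty A] [IsProbabilityMeasure P]
    (hrun : IsRun env F η β K P ℱ ctx act loss fhat) {f : C → A → ℝ}
    (hf : ∀ c a, f c a ∈ Set.Icc (0 : ℝ) 1) (hl : ∀ c a, env.meanLoss c a ∈ Set.Icc (0 : ℝ) 1)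
    {n : ℕ} (hn : n ≤ K) {ε : ℝ} (hε : 0 < ε) :
    P.real {ω | 16 * Real.log (1 / ε) +
        2 * (∑ t ∈ Finset.range n, (f (ctx t ω) (act t ω) - loss t ω) ^ 2 -
          ∑ t ∈ Finset.range n, (env.meanLoss (ctx t ω) (act t ω) - loss t ω) ^ 2) ≤
      ∑ t ∈ Finset.range n,
        meanSqError env.ctxProb (policy η β (fun i => fhat i ω) t) f env.meanLoss} ≤ ε := by
  have hd := env.ctxProb_mem_stdSimplex
  have hsq : ∀ c a, (f c a - env.meanLoss c a) ^ 2 ≤ 1 := fun c a => by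
    rw [sq_le_one_iff_abs_le_one, abs_le]
    constructor <;> linarith [(hf c a).1, (hf c a).2, (hl c a).1, (hl c a).2]
  have h := hrun.prob_log_le_sum_le
    (u := fun t ω _ _ =>
      meanSqError env.ctxProb (policy η β (fun i => fhat i ω) t) f env.meanLoss / 16)
    (h := fun c a x => -(1 / 8) * ((f c a - x) ^ 2 - (env.meanLoss c a - x) ^ 2))
    (H := fun c a => 1 - (f c a - env.meanLoss c a) ^ 2 / 16)
    (fun t ht c a => by
      simp only [meanSqError]
      refine Measurable.div_const ?_ _
      refine Finset.measurable_fun_sum _ fun c _ => Measurable.const_mul ?_ _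
      exact Finset.measurable_fun_sum _ fun a _ =>
        (hrun.policy_measurable t ht.le c a).mul_const _)
    (fun c a => by fun_prop)
    (fun c a => by linarith [hsq c a])
    (fun c a => env.lintegral_exp_excess_le c a (hf c a) (hl c a))
    (fun t _ ω => by
      set p := policy η β (fun i => fhat i ω) t with hp
      set m := meanSqError env.ctxProb p f env.meanLoss / 16 with hm
      have h1 : ∑ c, env.ctxProb c * ∑ a, Real.exp m * p c a *
          (1 - (f c a - env.meanLoss c a) ^ 2 / 16) = Real.exp m * (1 - m) := by
        have h2 : ∀ c, ∑ a, Real.exp m * p c a * (1 - (f c a - env.meanLoss c a) ^ 2 / 16) =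
            Real.exp m * (1 - (∑ a, p c a * (f c a - env.meanLoss c a) ^ 2) / 16) := by
          intro c
          have h3 : 1 - (∑ a, p c a * (f c a - env.meanLoss c a) ^ 2) / 16 =
              ∑ a, (p c a - p c a * (f c a - env.meanLoss c a) ^ 2 / 16) := by
            rw [Finset.sum_sub_distrib, hp, sum_policy, ← Finset.sum_div]
          rw [h3, Finset.mul_sum]
          exact Finset.sum_congr rfl fun a _ => by ring
        have h3 : (1 : ℝ) - m = ∑ c, (env.ctxProb c - env.ctxProb c *
            (∑ a, p c a * (f c a - env.meanLoss c a) ^ 2) / 16) := by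
          rw [Finset.sum_sub_distrib, hd.2, ← Finset.sum_div, hm, meanSqError]
        simp only [h2]
        rw [h3, Finset.mul_sum]
        exact Finset.sum_congr rfl fun c _ => by ring
      rw [h1]
      -- The loss moment averages to `1 - m` over contexts and arms; the compensator `exp m`
      -- restores at most `1`.
      have h4 := Real.one_sub_le_exp_neg m
      calc Real.exp m * (1 - m) ≤ Real.exp m * Real.exp (-m) :=
            mul_le_mul_of_nonneg_left h4 (Real.exp_pos _).le
        _ = 1 := by rw [← Real.exp_add]; simp)
    hn hε
  refine le_of_eq_of_le ?_ h
  congr 1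
  ext ω
  simp only [Set.mem_ofPred_eq]
  rw [Finset.sum_add_distrib, ← Finset.sum_div, ← Finset.mul_sum, Finset.sum_sub_distrib]
  constructor <;> intro h <;> linarith

/-- A multiplicative concentration bound for predictable context-dependent gains in `[0,1]`. -/
theorem IsRun.prob_gain_le [Nonempty A] [IsProbabilityMeasure P]
    (hrun : IsRun env F η β K P ℱ ctx act loss fhat) {x : ℕ → Ω → C → ℝ}
    (hx : ∀ t < K, ∀ c, Measurable[ℱ t] fun ω => x t ω c)
    (hx1 : ∀ t < K, ∀ ω c, x t ω c ∈ Set.Icc (0 : ℝ) 1) {ε : ℝ} (hε : 0 < ε) :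
    P.real {ω | Real.log (1 / ε) + 2 * ∑ t ∈ Finset.range K, ∑ c, env.ctxProb c * x t ω c ≤
      ∑ t ∈ Finset.range K, x t ω (ctx t ω)} ≤ ε := by
  have hd := env.ctxProb_mem_stdSimplex
  have h := hrun.prob_log_le_sum_le
    (u := fun t ω c _ => x t ω c - 2 * ∑ b, env.ctxProb b * x t ω b)
    (h := fun _ _ _ => 0) (H := fun _ _ => 1)
    (fun t ht c _ => (hx t ht c).sub (Measurable.const_mul
      (Finset.measurable_fun_sum _ fun b _ => (hx t ht b).const_mul _) _))
    (fun c a => measurable_const) (fun c a => zero_le_one)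
    (fun c a => by
      have := env.isProbabilityMeasure c a
      simp)
    (fun t ht ω => by
      set m := ∑ b, env.ctxProb b * x t ω b with hm
      simp only [mul_one, ← Finset.mul_sum, sum_policy]
      -- On `[0,1]`, `exp x ≤ 1 + x + x² ≤ 1 + 2x`; averaging gives `1 + 2m ≤ exp (2m)`, whence the
      -- factor `2`.
      have h1 : ∀ c, Real.exp (x t ω c - 2 * m) ≤ Real.exp (-(2 * m)) * (1 + 2 * x t ω c) := by
        intro c
        rw [sub_eq_neg_add, Real.exp_add]
        refine mul_le_mul_of_nonneg_left ?_ (Real.exp_pos _).le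
        have hc := hx1 t ht ω c
        have h2 := (abs_le.1 (Real.abs_exp_sub_one_sub_id_le
          (abs_le.2 ⟨by linarith [hc.1], hc.2⟩))).2
        nlinarith [hc.1, hc.2]
      calc ∑ c, env.ctxProb c * Real.exp (x t ω c - 2 * m) ≤
            ∑ c, env.ctxProb c * (Real.exp (-(2 * m)) * (1 + 2 * x t ω c)) :=
            Finset.sum_le_sum fun c _ => mul_le_mul_of_nonneg_left (h1 c) (hd.1 c)
        _ = Real.exp (-(2 * m)) * (∑ c, env.ctxProb c + 2 * m) := by
            rw [hm, Finset.mul_sum, ← Finset.sum_add_distrib, Finset.mul_sum]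
            exact Finset.sum_congr rfl fun c _ => by ring
        _ ≤ Real.exp (-(2 * m)) * Real.exp (2 * m) := by
            rw [hd.2]
            refine mul_le_mul_of_nonneg_left ?_ (Real.exp_pos _).le
            linarith [Real.add_one_le_exp (2 * m)]
        _ = 1 := by rw [← Real.exp_add]; simp)
    le_rfl hε
  refine le_of_eq_of_le ?_ h
  congr 1
  ext ω
  simp only [Set.mem_ofPred_eq, add_zero]
  rw [Finset.sum_sub_distrib, ← Finset.mul_sum, le_sub_iff_add_le]

end Run

/-! ### Choice of parameters and constants. -/

section Arithmetic

theorem log_explorationParam_arg_le {K N : ℕ} {δ : ℝ} (hK : 1 ≤ K) (hN : 2 ≤ (N : ℝ) / δ) :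
    Real.log (4 * N * (K : ℝ) ^ 3 / δ) ≤ 5 * Real.log (N / δ) * (1 + Real.log K) ∧
      1 ≤ Real.log (4 * N * (K : ℝ) ^ 3 / δ) := by
  have hK0 : (0 : ℝ) < K := by exact_mod_cast hK
  have hlogK : 0 ≤ Real.log K := Real.log_nonneg (by exact_mod_cast hK)
  have h1 : 4 * N * (K : ℝ) ^ 3 / δ = 2 ^ 2 * (N / δ) * (K : ℝ) ^ 3 := by ring
  have h2 : Real.log 2 ≤ Real.log (N / δ) := Real.log_le_log (by norm_num) hN
  have h3 := Real.log_two_gt_d9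
  rw [h1, Real.log_mul (by positivity) (by positivity), Real.log_mul (by norm_num) (by positivity),
    Real.log_pow, Real.log_pow]
  push_cast
  constructor
  · nlinarith
  · linarith

/-- The exploration parameter balances the two error terms of the expected regret. -/
theorem explorationParam_bounds {K m N : ℕ} {δ : ℝ} (hK : 1 ≤ K) (hm : 1 ≤ m)
    (hN : 2 ≤ (N : ℝ) / δ) :
    0 < explorationParam K m N δ ∧
      explorationParam K m N δ * m ≤
        14 * ((1 + Real.log K) * Real.sqrt (K * m * Real.log (N / δ))) ∧
      K * ((1 + 16 * Real.log (4 * N * (K : ℝ) ^ 3 / δ)) / explorationParam K m N δ) ≤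
        explorationParam K m N δ * m / 2 := by
  obtain ⟨hΛ, hΛ1⟩ := log_explorationParam_arg_le hK hN
  have hK0 : (0 : ℝ) < K := by exact_mod_cast hK
  have hm0 : (0 : ℝ) < m := by exact_mod_cast hm
  have hlogK : 0 ≤ Real.log K := Real.log_nonneg (by exact_mod_cast hK)
  have hL : 0 < Real.log (N / δ) := Real.log_pos (by linarith)
  set Λ := Real.log (4 * N * (K : ℝ) ^ 3 / δ) with hΛdef
  set L := Real.log (N / δ) with hLdef
  set β := explorationParam K m N δ with hβdef
  have hβ0 : 0 < β := Real.sqrt_pos.2 (by positivity)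
  have hβ2 : β ^ 2 = 34 * K * Λ / m := Real.sq_sqrt (by positivity)
  have hβm : β ^ 2 * m = 34 * K * Λ := by rw [hβ2]; field_simp
  refine ⟨hβ0, ?_, ?_⟩
  · have h1 : (β * m) ^ 2 ≤ (14 * ((1 + Real.log K) * Real.sqrt (K * m * L))) ^ 2 := by
      rw [mul_pow 14, mul_pow (1 + Real.log K), Real.sq_sqrt (by positivity)]
      have h2 : (β * m) ^ 2 = 34 * (K * m) * Λ := by
        rw [mul_pow, sq (m : ℝ), ← mul_assoc, hβm]
        ring
      have h3 : 1 + Real.log K ≤ (1 + Real.log K) ^ 2 := by nlinarith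
      have h4 := mul_le_mul_of_nonneg_left hΛ (by positivity : (0 : ℝ) ≤ 34 * (K * m))
      have h5 := mul_le_mul_of_nonneg_left h3 (by positivity : (0 : ℝ) ≤ K * m * L)
      have h6 : 0 ≤ K * m * L * (1 + Real.log K) ^ 2 := by positivity
      rw [h2]
      nlinarith
    exact (sq_le_sq₀ (by positivity) (by positivity)).1 h1
  -- As `1 ≤ Λ`, `1 + 16Λ ≤ 17Λ`, and `17` is half of the `34` in `β² m = 34 K Λ`.
  · rw [← mul_div_assoc, div_le_iff₀ hβ0]
    nlinarith

/-- After division by `η`, both `log m / η` and `K η / 2` are of order `√(K log m)`; `m ≥ 2` is what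
makes `η` positive. -/
theorem expWeights_tuning {r₁ r₂ η B E : ℝ} {K m : ℕ} (hr₁ : 0 < r₁) (hK : 1 ≤ K) (hm : 2 ≤ m)
    (hη₁ : r₁ * Real.sqrt (Real.log m / K) ≤ η) (hη₂ : η ≤ r₂ * Real.sqrt (Real.log m / K))
    (hE : η * E ≤ Real.log m + K * (η ^ 2 / 2) + η * B) :
    E ≤ (1 / r₁ + r₂ / 2) * Real.sqrt (K * Real.log m) + B := by
  have hK0 : (0 : ℝ) < K := by exact_mod_cast hK
  have hlog : 0 < Real.log m := Real.log_pos (by exact_mod_cast hm)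
  set a := Real.sqrt (Real.log m / K) with ha
  have ha0 : 0 < a := Real.sqrt_pos.2 (by positivity)
  have hη : 0 < η := (mul_pos hr₁ ha0).trans_le hη₁
  have hsq : a ^ 2 * K = Real.log m := by
    rw [ha, Real.sq_sqrt (by positivity)]
    field_simp
  have hs : Real.sqrt (K * Real.log m) = K * a := by
    rw [← hsq, show K * (a ^ 2 * K) = (K * a) ^ 2 by ring, Real.sqrt_sq (by positivity)]
  rw [hs]
  refine le_of_mul_le_mul_left (hE.trans ?_) hη
  have h1 : Real.log m ≤ η * (1 / r₁ * (K * a)) := by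
    rw [← hsq]
    have h2 : a ≤ η / r₁ := by
      rw [le_div_iff₀ hr₁]
      linarith
    calc a ^ 2 * K = a * (K * a) := by ring
      _ ≤ η / r₁ * (K * a) := mul_le_mul_of_nonneg_right h2 (by positivity)
      _ = _ := by ring
  have h3 : K * (η ^ 2 / 2) ≤ η * (r₂ / 2 * (K * a)) := by
    have := mul_le_mul_of_nonneg_left hη₂ (by positivity : 0 ≤ K * η / 2)
    linarith
  linarith

theorem regret_constants {r₁ r₂ η E R δ : ℝ} {K m N : ℕ} (hr₁ : 0 < r₁) (hr : r₁ ≤ r₂) (hK : 1 ≤ K)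
    (hm : 2 ≤ m) (hδ : 0 < δ) (hδ1 : δ < 1) (hN : 2 ≤ (N : ℝ) / δ)
    (hη₁ : r₁ * Real.sqrt (Real.log m / K) ≤ η) (hη₂ : η ≤ r₂ * Real.sqrt (Real.log m / K))
    (hE : η * E ≤ Real.log m + K * (η ^ 2 / 2) +
      η * (2 * (explorationParam K m N δ * m * (1 + Real.log K)) +
        K * ((1 + 16 * Real.log (4 * N * (K : ℝ) ^ 3 / δ)) / explorationParam K m N δ)))
    (hE0 : 0 ≤ E) (hRK : R ≤ K) (hR : R ≤ 2 * E + Real.log (1 / (δ / 2))) :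
    R ≤ (4 / r₁ + 2 * r₂ + 72) * (1 + Real.log K) ^ 2 *
      Real.sqrt (K * m * Real.log (N / δ)) := by
  obtain ⟨-, hβ1, hβ2⟩ := explorationParam_bounds (m := m) hK (by omega) hN
  have hK0 : (0 : ℝ) < K := by exact_mod_cast hK
  have hm0 : (2 : ℝ) ≤ m := by exact_mod_cast hm
  have hlogK : 0 ≤ Real.log K := Real.log_nonneg (by exact_mod_cast hK)
  have hL2 : Real.log 2 ≤ Real.log (N / δ) := Real.log_le_log (by norm_num) hN
  have hl2 := Real.log_two_gt_d9
  have hL : 0 < Real.log (N / δ) := by linarith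
  have hE' := expWeights_tuning hr₁ hK hm hη₁ hη₂ hE
  set L := Real.log (N / δ) with hLdef
  set s := Real.sqrt (K * m * L) with hs
  set k := 1 + Real.log K with hk
  have hk1 : 1 ≤ k := by linarith
  have hs0 : 0 ≤ s := Real.sqrt_nonneg _
  have h2s : ∀ {y : ℝ}, y ≤ 4 * (m * L) → Real.sqrt (K * y) ≤ 2 * s := fun {y} hy => by
    refine Real.sqrt_le_iff.2 ⟨by linarith, ?_⟩
    rw [mul_pow, hs, Real.sq_sqrt (by positivity)]
    nlinarith [mul_le_mul_of_nonneg_left hy hK0.le]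
  have h1 : Real.sqrt (K * Real.log m) ≤ 2 * s := by
    have h2 : Real.log m ≤ m := (Real.log_le_sub_one_of_pos (by linarith)).trans (by linarith)
    exact h2s (by nlinarith)
  have hN0 : (1 : ℝ) ≤ N := by
    rcases Nat.eq_zero_or_pos N with h | h
    · rw [h] at hN
      norm_num at hN
    · exact_mod_cast h
  -- Both factors of `2 * (1 / δ)` are at most `N / δ`.
  have hlogδ : Real.log (1 / (δ / 2)) ≤ 2 * L := by
    have h2 : 1 / (δ / 2) ≤ (N / δ) ^ 2 := by
      have h3 : 1 / (δ / 2) = 2 * (1 / δ) := by field_simp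
      have h4 : 1 / δ ≤ N / δ := div_le_div_of_nonneg_right hN0 hδ.le
      rw [h3, sq]
      exact mul_le_mul hN h4 (by positivity) (by positivity)
    have h3 := Real.log_le_log (by positivity) h2
    rw [Real.log_pow] at h3
    exact_mod_cast h3
  have hlogδ0 : 0 ≤ Real.log (1 / (δ / 2)) :=
    Real.log_nonneg (by rw [le_div_iff₀ (by linarith)]; linarith)
  -- For tiny `δ` the term `log (2 / δ)` may exceed the target; combining it with `R ≤ K` and `min K
  -- y ≤ √(K y)` repairs this.
  have hmin : R ≤ 2 * E + 2 * s := by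
    have h2 : Real.sqrt (K * Real.log (1 / (δ / 2))) ≤ 2 * s := h2s (by nlinarith)
    rcases le_total (K : ℝ) (Real.log (1 / (δ / 2))) with h | h
    · have : (K : ℝ) ≤ Real.sqrt (K * Real.log (1 / (δ / 2))) :=
        Real.le_sqrt_of_sq_le (by rw [sq]; exact mul_le_mul_of_nonneg_left h hK0.le)
      linarith
    · have : Real.log (1 / (δ / 2)) ≤ Real.sqrt (K * Real.log (1 / (δ / 2))) :=
        Real.le_sqrt_of_sq_le (by rw [sq]; exact mul_le_mul_of_nonneg_right h hlogδ0)
      linarith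
  have hks : s ≤ k ^ 2 * s := le_mul_of_one_le_left hs0 (one_le_pow₀ hk1)
  have hks' : k * s ≤ k ^ 2 * s := mul_le_mul_of_nonneg_right (by nlinarith) hs0
  have hr₂ : 0 < r₂ := hr₁.trans_le hr
  have hc : 0 ≤ 1 / r₁ + r₂ / 2 := by positivity
  have h2 := mul_le_mul_of_nonneg_left (h1.trans (mul_le_mul_of_nonneg_left hks zero_le_two)) hc
  have h3 := mul_le_mul_of_nonneg_right hβ1 (by linarith : 0 ≤ k)
  -- `72 = 56 + 14 + 2`: twice the bonus term `2 * 14`, twice the confidence term `14 / 2`, and the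
  -- deviation term `2 * s`.
  have h4 : (4 / r₁ + 2 * r₂ + 72) * k ^ 2 * s =
      2 * ((1 / r₁ + r₂ / 2) * (2 * (k ^ 2 * s))) + 72 * (k ^ 2 * s) := by ring
  have h5 : 14 * (k * s) * k = 14 * (k ^ 2 * s) := by ring
  rw [h4]
  rw [h5] at h3
  linarith

end Arithmetic

theorem Realizable.meanLoss_mem_Icc {C A : Type*} {env : CMAB C A} {F : Finset (C → A → ℝ)}
    (hF : Realizable env F) (c : C) (a : A) :
    env.meanLoss c a ∈ Set.Icc (0 : ℝ) 1 := by
  obtain ⟨f, hf, hfl⟩ := hF.2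
  exact hfl c a ▸ hF.1 f hf c a

/-! ### Assembly of the high-probability bound. -/

section Regret

variable {C A Ω : Type*} [Fintype A] [mΩ : MeasurableSpace Ω]
  {env : CMAB C A} {F : Finset (C → A → ℝ)} {η β : ℝ} {K : ℕ} {P : Measure Ω}
  {ℱ : Filtration ℕ mΩ} {ctx : ℕ → Ω → C} {act : ℕ → Ω → A} {loss : ℕ → Ω → ℝ}
  {fhat : ℕ → Ω → C → A → ℝ}

/-- Optimality in every context gives the nonnegativity required by `IsRun.prob_gain_le`. -/
theorem IsOptimalPolicy.gap_mem_Icc {q : C → A → ℝ} (hq : IsOptimalPolicy env q)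
    (hl : ∀ c a, env.meanLoss c a ∈ Set.Icc (0 : ℝ) 1) (c : C) {p : A → ℝ}
    (hp : p ∈ stdSimplex ℝ A) :
    ∑ a, (p a - q c a) * env.meanLoss c a ∈ Set.Icc (0 : ℝ) 1 := by
  simp only [sub_mul, Finset.sum_sub_distrib]
  have h1 := (hq c).2 p hp
  have h2 := sum_mul_mem_Icc hp (hl c)
  have h3 := sum_mul_mem_Icc (hq c).1 (hl c)
  exact ⟨by linarith, by linarith [h2.2, h3.1]⟩

variable [Fintype C]

/-- With high probability, every least-squares regressor is accurate under the past policies. -/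
theorem IsRun.prob_exists_lt_meanSqError_le [Nonempty A] [IsProbabilityMeasure P]
    (hrun : IsRun env F η β K P ℱ ctx act loss fhat) (hF : Realizable env F) {ε : ℝ} (hε : 0 < ε) :
    P.real {ω | ∃ t < K, 16 * Real.log (1 / ε) ≤ ∑ i ∈ Finset.range t,
      meanSqError env.ctxProb (policy η β (fun i => fhat i ω) i) (fhat t ω) env.meanLoss} ≤
      K * F.card * ε := by
  obtain ⟨g, hg, hgl⟩ := hF.2
  let S : ℕ → (C → A → ℝ) → Set Ω := fun t f => {ω | 16 * Real.log (1 / ε) +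
        2 * (∑ i ∈ Finset.range t, (f (ctx i ω) (act i ω) - loss i ω) ^ 2 -
          ∑ i ∈ Finset.range t, (env.meanLoss (ctx i ω) (act i ω) - loss i ω) ^ 2) ≤
      ∑ i ∈ Finset.range t,
        meanSqError env.ctxProb (policy η β (fun i => fhat i ω) i) f env.meanLoss}
  have hsub : {ω | ∃ t < K, 16 * Real.log (1 / ε) ≤ ∑ i ∈ Finset.range t,
      meanSqError env.ctxProb (policy η β (fun i => fhat i ω) i) (fhat t ω) env.meanLoss} ⊆
      -- The bound is available only for fixed `f`; the regressor is one of them, and its excess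
      -- loss is nonpositive.
      ⋃ t ∈ Finset.range K, ⋃ f ∈ F, S t f := by
    rintro ω ⟨t, ht, hω⟩
    obtain ⟨hmem, hls⟩ := hrun.fhat_leastSquares t ht ω
    have h := hls g hg
    simp only [hgl] at h
    simp only [Set.mem_iUnion]
    refine ⟨t, Finset.mem_range.2 ht, fhat t ω, hmem, ?_⟩
    rw [Set.mem_ofPred_eq]
    linarith
  refine (measureReal_mono hsub (measure_ne_top _ _)).trans ?_
  refine (measureReal_biUnion_finset_le _ _).trans ?_
  have h1 : ∀ t ∈ Finset.range K, P.real (⋃ f ∈ F, S t f) ≤ F.card * ε := by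
    intro t ht
    refine (measureReal_biUnion_finset_le _ _).trans ?_
    rw [← nsmul_eq_mul]
    exact Finset.sum_le_card_nsmul _ _ _ fun f hf => hrun.prob_excess_le (hF.1 f hf)
      hF.meanLoss_mem_Icc (Finset.mem_range.1 ht).le hε
  refine (Finset.sum_le_card_nsmul _ _ _ h1).trans ?_
  rw [Finset.card_range, nsmul_eq_mul, mul_assoc]

theorem IsRun.one_sub_le_prob_regret_le [Nonempty A] [IsProbabilityMeasure P] {r₁ r₂ δ : ℝ}
    {q : C → A → ℝ} (hr₁ : 0 < r₁) (hr : r₁ ≤ r₂) (hF : Realizable env F) (hK : 1 ≤ K)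
    (hδ : 0 < δ) (hδ1 : δ < 1) (hN : 2 ≤ (F.card : ℝ) / δ) (hA : 2 ≤ Fintype.card A)
    (hη₁ : r₁ * Real.sqrt (Real.log (Fintype.card A) / K) ≤ η)
    (hη₂ : η ≤ r₂ * Real.sqrt (Real.log (Fintype.card A) / K))
    (hβ : β = explorationParam K (Fintype.card A) F.card δ)
    (hrun : IsRun env F η β K P ℱ ctx act loss fhat) (hq : IsOptimalPolicy env q) :
    1 - δ ≤ P.real {ω | regret env η β K q (fun t => ctx t ω) (fun t => fhat t ω) ≤
      (4 / r₁ + 2 * r₂ + 72) * (1 + Real.log K) ^ 2 *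
        Real.sqrt (K * Fintype.card A * Real.log (F.card / δ))} := by
  have hl := hF.meanLoss_mem_Icc
  have hd := env.ctxProb_mem_stdSimplex
  have hK1 : (1 : ℝ) ≤ K := by exact_mod_cast hK
  have hN1 : (1 : ℝ) ≤ F.card := by
    obtain ⟨g, hg, -⟩ := hF.2
    exact_mod_cast Finset.card_pos.2 ⟨g, hg⟩
  let x : ℕ → Ω → C → ℝ := fun t ω c =>
    ∑ a, (policy η β (fun i => fhat i ω) t c a - q c a) * env.meanLoss c a
  have hx : ∀ t < K, ∀ c, Measurable[ℱ t] fun ω => x t ω c := fun t ht c =>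
    Finset.measurable_fun_sum _ fun a _ =>
      ((hrun.policy_measurable t ht.le c a).sub measurable_const).mul_const _
  have hx1 : ∀ t ω c, x t ω c ∈ Set.Icc (0 : ℝ) 1 := fun t ω c =>
    hq.gap_mem_Icc hl c (policy_mem_stdSimplex η β _ t c)
  have hη : 0 ≤ η := le_trans (by positivity) hη₁
  have hβ0 : 0 < β := hβ ▸ (explorationParam_bounds hK (by omega) hN).1
  -- Each of the `K * F.card` pairs of a round and a function gets an equal share of `δ / 2`.
  set ε := δ / (2 * F.card * K) with hε
  have hε0 : 0 < ε := by positivity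
  have hlogε : Real.log (1 / ε) ≤ Real.log (4 * F.card * (K : ℝ) ^ 3 / δ) := by
    refine Real.log_le_log (by positivity) ?_
    rw [hε, one_div_div]
    refine div_le_div_of_nonneg_right ?_ hδ.le
    have : (K : ℝ) ≤ (K : ℝ) ^ 3 := le_self_pow₀ hK1 (by norm_num)
    nlinarith
  set B₁ : Set Ω := {ω | ∃ t < K, 16 * Real.log (1 / ε) ≤ ∑ i ∈ Finset.range t,
    meanSqError env.ctxProb (policy η β (fun i => fhat i ω) i) (fhat t ω) env.meanLoss} with hB₁
  set B₂ : Set Ω := {ω | Real.log (1 / (δ / 2)) +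
    2 * ∑ t ∈ Finset.range K, ∑ c, env.ctxProb c * x t ω c ≤
      ∑ t ∈ Finset.range K, x t ω (ctx t ω)} with hB₂
  have h1 : P.real B₁ ≤ δ / 2 := by
    refine (hrun.prob_exists_lt_meanSqError_le hF hε0).trans (le_of_eq ?_)
    rw [hε]
    field_simp
  have h2 : P.real B₂ ≤ δ / 2 := hrun.prob_gain_le hx (fun t _ => hx1 t) (by linarith)
  set G : Set Ω := {ω | regret env η β K q (fun t => ctx t ω) (fun t => fhat t ω) ≤
      (4 / r₁ + 2 * r₂ + 72) * (1 + Real.log K) ^ 2 *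
        Real.sqrt (K * Fintype.card A * Real.log (F.card / δ))} with hG
  -- A cover and subadditivity avoid any question of measurability of the events.
  have hcover : Set.univ ⊆ G ∪ (B₁ ∪ B₂) := by
    intro ω _
    by_cases hω1 : ω ∈ B₁
    · exact Or.inr (Or.inl hω1)
    by_cases hω2 : ω ∈ B₂
    · exact Or.inr (Or.inr hω2)
    left
    have hS : ∀ t < K, ∑ i ∈ Finset.range t, meanSqError env.ctxProb
        (policy η β (fun i => fhat i ω) i) (fhat t ω) env.meanLoss ≤
        16 * Real.log (4 * F.card * (K : ℝ) ^ 3 / δ) := by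
      intro t ht
      by_contra hcon
      exact hω1 ⟨t, ht, by linarith⟩
    have hf : ∀ t < K, ∀ c a, fhat t ω c a ∈ Set.Icc (0 : ℝ) 1 := fun t ht =>
      hF.1 _ (hrun.fhat_leastSquares t ht ω).1
    have hE := expected_regret_le (f := fun i => fhat i ω) hη hβ0 hK hd (fun c => (hq c).1) hl hf hS
    have hR : ∑ t ∈ Finset.range K, x t ω (ctx t ω) ≤
        2 * ∑ t ∈ Finset.range K, ∑ c, env.ctxProb c * x t ω c + Real.log (1 / (δ / 2)) := by
      by_contra hcon
      exact hω2 (by rw [hB₂, Set.mem_ofPred_eq]; linarith)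
    have hRK : ∑ t ∈ Finset.range K, x t ω (ctx t ω) ≤ K := by
      simpa using Finset.sum_le_sum fun t (_ : t ∈ Finset.range K) => (hx1 t ω (ctx t ω)).2
    have hE0 : 0 ≤ ∑ t ∈ Finset.range K, ∑ c, env.ctxProb c * x t ω c :=
      Finset.sum_nonneg fun t _ => Finset.sum_nonneg fun c _ =>
        mul_nonneg (hd.1 c) (hx1 t ω c).1
    rw [hβ] at hE
    refine regret_constants hr₁ hr hK hA hδ hδ1 hN hη₁ hη₂ ?_ hE0 hRK hR
    simp only [x]
    rw [hβ]
    exact hE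
  have h3 : (1 : ℝ) ≤ P.real (G ∪ (B₁ ∪ B₂)) := by
    rw [← probReal_univ (μ := P)]
    exact measureReal_mono hcover
  have h4 := measureReal_union_le (μ := P) G (B₁ ∪ B₂)
  have h5 := measureReal_union_le (μ := P) B₁ B₂
  linarith

end Regret

end OPOCMAB

theorem theorem1 :
    ∃ p : ℕ, ∀ r₁ r₂ : ℝ, 0 < r₁ → r₁ ≤ r₂ → ∃ M : ℝ, 0 < M ∧
      ∀ (C A Ω : Type*) [Fintype C] [Fintype A] [mΩ : MeasurableSpace Ω]
        (P : MeasureTheory.Measure Ω) [MeasureTheory.IsProbabilityMeasure P]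
        (env : OPOCMAB.CMAB C A) (F : Finset (C → A → ℝ)) (K : ℕ) (δ η : ℝ)
        (ℱ : MeasureTheory.Filtration ℕ mΩ)
        (ctx : ℕ → Ω → C) (act : ℕ → Ω → A) (loss : ℕ → Ω → ℝ) (fhat : ℕ → Ω → C → A → ℝ)
        (q : C → A → ℝ),
        OPOCMAB.Realizable env F → 1 ≤ K → 0 < δ → δ < 1 → 2 ≤ (F.card : ℝ) / δ →
        r₁ * Real.sqrt (Real.log (Fintype.card A) / K) ≤ η →
        η ≤ r₂ * Real.sqrt (Real.log (Fintype.card A) / K) →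
        OPOCMAB.IsRun env F η (OPOCMAB.explorationParam K (Fintype.card A) F.card δ) K P
          ℱ ctx act loss fhat →
        OPOCMAB.IsOptimalPolicy env q →
        1 - δ ≤ P.real {ω |
          OPOCMAB.regret env η (OPOCMAB.explorationParam K (Fintype.card A) F.card δ) K q
              (fun t => ctx t ω) (fun t => fhat t ω)
            ≤ M * (1 + Real.log K) ^ p
              * Real.sqrt (K * Fintype.card A * Real.log (F.card / δ))} := by
  refine ⟨2, fun r₁ r₂ hr₁ hr => ?_⟩
  have hr₂ : 0 < r₂ := hr₁.trans_le hr
  refine ⟨4 / r₁ + 2 * r₂ + 72, by positivity, ?_⟩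
  intro C A Ω _ _ _ P _ env F K δ η ℱ ctx act loss fhat q hF hK hδ hδ1 hN hη₁ hη₂ hrun hq
  obtain ⟨c₀, -⟩ := env.ctxDist.support_nonempty
  have hA : Nonempty A := by
    by_contra h
    rw [not_nonempty_iff] at h
    simpa using (hq c₀).1.2
  -- With a single arm `log |A| = 0` forces `η = 0`, so the tuning argument fails, but all policies
  -- coincide and the regret vanishes.
  rcases Nat.lt_or_ge (Fintype.card A) 2 with h | h
  · have : Subsingleton A := Fintype.card_le_one_iff_subsingleton.1 (by omega)
    have hpq : ∀ f : ℕ → C → A → ℝ, ∀ t c a, OPOCMAB.policy η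
        (OPOCMAB.explorationParam K (Fintype.card A) F.card δ) f t c a = q c a := by
      intro f t c a
      have h1 := OPOCMAB.sum_policy η
        (OPOCMAB.explorationParam K (Fintype.card A) F.card δ) f t c
      have h2 := (hq c).1.2
      rw [Fintype.sum_subsingleton _ a] at h1 h2
      rw [h1, h2]
    have hlogK : 0 ≤ Real.log K := Real.log_nonneg (by exact_mod_cast hK)
    have hall : ∀ ω, OPOCMAB.regret env η
        (OPOCMAB.explorationParam K (Fintype.card A) F.card δ) K q (fun t => ctx t ω)
          (fun t => fhat t ω) ≤ (4 / r₁ + 2 * r₂ + 72) * (1 + Real.log K) ^ 2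
              * Real.sqrt (K * Fintype.card A * Real.log (F.card / δ)) := by
      intro ω
      simp only [OPOCMAB.regret, hpq, sub_self, zero_mul, Finset.sum_const_zero]
      positivity
    simp only [hall, Set.ofPred_true, probReal_univ]
    linarith
  · exact hrun.one_sub_le_prob_regret_le hr₁ hr hF hK hδ hδ1 hN h hη₁ hη₂ rfl hq
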